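/- **Theorem 1.2.** Let $n \ge 1$, let $X_1,\dots,X_n$ be independent Bernoulli random variables with $\mathbb P\{X_j=1\}=p_j$ and $\mathbb P\{X_j=0\}=1-p_j$, where $p_j\in[0,1]$, and let $W=X_1+\dots+X_n$. Put $$\lambda=\sum_{j=1}^n p_j,\qquad \lambda_2=\sum_{j=1}^n p_j^2,$$ suppose that $\lambda>0$, and let $Z$ be a Poisson random variable with parameter $\lambda$. Write $w_k=\mathbb P\{W=k\}$ and $v_k=\mathbb P\{Z=k\}=e^{-\lambda}\lambda^k/k!$ for $k=0,1,2,\dots$, and $$D(W\|Z)=\sum_{k=0}^\infty w_k\log\frac{w_k}{v_k},\qquad \chi^2(W,Z)=\sum_{k=0}^\infty\frac{(w_k-v_k)^2}{v_k}$$ (with $0\log 0=0$). If $\lambda_2\le\lambda/2$, then $$D(W\|Z)\,\le\,\chi^2(W,Z)\,\le\,c\,\Big(\frac{\lambda_2}{\lambda}\Big)^2$$ with the absolute constant $c=56\cdot 10^6$. If moreover $\lambda\le 1/2$, then the same inequalities hold with $c=15$. -/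

import Mathlib

open MeasureTheory ProbabilityTheory InformationTheory
open scoped NNReal ENNReal

/-- The Pearson `χ²`-divergence `∑ₖ (P{k} - Q{k})² / Q{k}` of two probability measures on `ℕ`,
with values in `[0, ∞]` (so a divergent series has the sum `∞`). The division is that of `ℝ≥0∞`:
`0 / 0 = 0`, and `x / 0 = ∞` for `x ≠ 0`. -/
noncomputable def chiSqDiv (P Q : Measure ℕ) : ℝ≥0∞ :=
  ∑' k : ℕ, ENNReal.ofReal ((P.real {k} - Q.real {k}) ^ 2) / Q {k}

/-! Expand the density of `W` against the Poisson law in Charlier polynomials. Parseval gives `1 +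
χ² = ∑ c_r² r! / λ^r`, where `c_r` is the coefficient of `t^r` in `E[exp(-λt) (1+t)^W] = ∏ (1 + p_j
t) exp(-p_j t)`. Here `c_0 = 1`, and `c_1 = 0` because the means agree, so `χ²` is the tail from `r
= 2`. The bound `|(1+z) exp(-z)| ≤ exp(|z|²/2)` controls the product by `exp(λ₂|t|²/2)`. Cauchy's
estimate and Stirling's formula then bound the `r`-th term by `(r + 9/4) (λ₂/λ)^r`, and the tail is
at most `(21/2) (λ₂/λ)²` when `λ₂/λ ≤ 1/2`. The divergence comparison is pointwise, from `log x ≤ x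
- 1`. -/

open scoped Nat in
/-- The coefficient of `t ^ r` in `exp (-a t) (1 + t) ^ k`: the Charlier polynomial of degree `r`
with parameter `a` evaluated at `k`, up to normalization. -/
noncomputable def charlierCoeff (a : ℝ) : ℕ → ℕ → ℝ
  | 0, r => (-a) ^ r / r !
  | k + 1, 0 => charlierCoeff a k 0
  | k + 1, r + 1 => charlierCoeff a k (r + 1) + charlierCoeff a k r

/-! ### Recurrences, generating function and orthogonality of the Charlier polynomials. -/

namespace charlierCoeff

open scoped Nat

variable {a : ℝ}

lemma zero_right (k : ℕ) : charlierCoeff a k 0 = 1 := by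
  induction k with
  | zero => simp [charlierCoeff]
  | succ k ih => simpa [charlierCoeff] using ih

lemma one_right (k : ℕ) : charlierCoeff a k 1 = k - a := by
  induction k with
  | zero => simp [charlierCoeff]
  | succ k ih =>
    rw [charlierCoeff, ih, zero_right]
    push_cast
    ring

lemma succ_succ (k r : ℕ) : charlierCoeff a (k + 1) (r + 1) =
    charlierCoeff a k (r + 1) + charlierCoeff a k r := by
  rw [charlierCoeff]

lemma succ_mul_succ_zero (r : ℕ) :
    (r + 1) * charlierCoeff a 0 (r + 1) = -a * charlierCoeff a 0 r := by
  simp only [charlierCoeff, Nat.factorial_succ]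
  push_cast
  field_simp
  ring

/-- Compare coefficients in the `t`-derivative of `exp(-at) (1+t)^(k+1)`. -/
lemma succ_mul_succ (k r : ℕ) :
    (r + 1) * charlierCoeff a (k + 1) (r + 1) =
      -a * charlierCoeff a (k + 1) r + (k + 1) * charlierCoeff a k r := by
  induction k generalizing r with
  | zero =>
    cases r with
    | zero => simp [charlierCoeff]
    | succ r =>
      have h₁ := succ_mul_succ_zero (a := a) (r + 1)
      have h₂ := succ_mul_succ_zero (a := a) r
      rw [succ_succ, succ_succ]
      push_cast at *
      linear_combination h₁ + h₂
  | succ k ih =>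
    cases r with
    | zero =>
      rw [zero_add, one_right, zero_right, zero_right]
      push_cast
      ring
    | succ r =>
      have h₁ := ih (r + 1)
      have h₂ := ih r
      rw [succ_succ, succ_succ (k + 1) r]
      push_cast at *
      linear_combination h₁ + h₂ - (k + 1) * succ_succ (a := a) k r

/-- The exponential generating function of the Charlier polynomials. -/
lemma hasSum_mul_pow (k : ℕ) (t : ℂ) :
    HasSum (fun r ↦ (charlierCoeff a k r : ℂ) * t ^ r) (Complex.exp (-a * t) * (1 + t) ^ k) := by
  induction k with
  | zero =>
    have h := NormedSpace.expSeries_div_hasSum_exp (𝔸 := ℂ) (-a * t)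
    rw [← Complex.exp_eq_exp_ℂ] at h
    convert! h using 1
    · ext r
      simp only [charlierCoeff]
      push_cast
      rw [mul_pow]
      ring
    · simp
  | succ k ih =>
    have h : HasSum (fun r ↦ (charlierCoeff a k (r + 1) : ℂ) * t ^ (r + 1))
        (Complex.exp (-a * t) * (1 + t) ^ k - 1) := by
      simpa [zero_right] using (hasSum_nat_add_iff' 1).2 ih
    rw [← hasSum_nat_add_iff' 1]
    convert! h.add (ih.mul_right t) using 1
    · ext r
      rw [charlierCoeff]
      push_cast
      ring
    · simp [zero_right]
      ring

lemma hasSum_neg_one_pow (k : ℕ) :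
    HasSum (fun r ↦ charlierCoeff a k r * (-1) ^ r) (if k = 0 then Real.exp a else 0) := by
  have h := hasSum_mul_pow (a := a) k (-1)
  rw [← Complex.hasSum_ofReal]
  convert! h using 1
  · ext r; push_cast; rfl
  · by_cases hk : k = 0 <;> simp [hk]

/-- Dual orthogonality of the Charlier polynomials. -/
lemma hasSum_mul_mul (ha : a ≠ 0) (k l : ℕ) :
    HasSum (fun r ↦ charlierCoeff a k r * charlierCoeff a l r * (r ! / a ^ r))
      (if k = l then Real.exp a * k ! / a ^ k else 0) := by
  induction k generalizing l with
  | zero =>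
    -- For `k = 0` the weight `r!/a^r` cancels against the coefficient and leaves `(-1)^r`: the
    -- generating function at `t = -1`.
    convert! hasSum_neg_one_pow (a := a) l using 1
    · ext r
      simp only [charlierCoeff]
      rw [neg_pow]
      field_simp
    · by_cases h : l = 0
      · simp [h]
      · simp [h, Ne.symm h]
  | succ k ih =>
    -- The factor `r + 1` of `(r+1)!` is absorbed by the derivative recurrence in `l`, which reduces
    -- the shifted sum to the induction hypothesis at `l` and `l - 1`.
    have hsh : HasSum (fun r ↦ charlierCoeff a k r * charlierCoeff a l (r + 1) *
        ((r + 1)! / a ^ (r + 1)))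
        ((if k + 1 = l then Real.exp a * (k + 1)! / a ^ (k + 1) else 0) -
          (if k = l then Real.exp a * k ! / a ^ k else 0)) := by
      cases l with
      | zero =>
        convert! (ih 0).neg using 1
        · ext r
          have h := succ_mul_succ_zero (a := a) r
          rw [Nat.factorial_succ]
          push_cast
          field_simp
          linear_combination charlierCoeff a k r * a ^ r * h
        · simp
      | succ l =>
        convert! (ih (l + 1)).neg.add ((ih l).mul_left ((l + 1) / a)) using 1
        · ext r
          have h := succ_mul_succ (a := a) l r
          rw [Nat.factorial_succ]
          push_cast
          field_simp
          linear_combination charlierCoeff a k r * a * a ^ r * h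
        · by_cases h : k = l
          · subst h
            simp [Nat.factorial_succ]
            field_simp
            ring
          · simp [h]
    rw [← hasSum_nat_add_iff' 1]
    have h := ih l
    rw [← hasSum_nat_add_iff' 1] at h
    convert! h.add hsh using 1
    · ext r
      rw [charlierCoeff]
      ring
    · simp [charlierCoeff]

end charlierCoeff

open scoped Nat in
/-- Parseval's identity for the Charlier expansion of a finitely supported density. -/
lemma hasSum_sq_sum_charlierCoeff {a : ℝ} (ha : a ≠ 0) (s : Finset ℕ) (w : ℕ → ℝ) :
    HasSum (fun r ↦ (∑ k ∈ s, w k * charlierCoeff a k r) ^ 2 * (r ! / a ^ r))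
      (∑ k ∈ s, w k ^ 2 * (Real.exp a * k ! / a ^ k)) := by
  have h := hasSum_sum (s := s) fun k _ ↦ hasSum_sum (s := s) fun l _ ↦
    (charlierCoeff.hasSum_mul_mul ha k l).mul_left (w k * w l)
  convert! h using 1
  · ext r
    rw [sq, Finset.sum_mul_sum, Finset.sum_mul]
    refine Finset.sum_congr rfl fun k _ ↦ ?_
    rw [Finset.sum_mul]
    refine Finset.sum_congr rfl fun l _ ↦ ?_
    ring
  · refine Finset.sum_congr rfl fun k hk ↦ ?_
    simp only [mul_ite, mul_zero, Finset.sum_ite_eq, hk, if_true]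
    ring

/-! ### Coefficient estimates. -/

/-- Cauchy's estimate for the coefficients of an everywhere convergent power series. -/
lemma norm_le_of_hasSum_mul_pow {f : ℂ → ℂ} {c : ℕ → ℂ}
    (hf : ∀ t, HasSum (fun r ↦ c r * t ^ r) (f t)) {R C : ℝ} (hR : 0 < R)
    (hC : ∀ t, ‖t‖ = R → ‖f t‖ ≤ C) (r : ℕ) : ‖c r‖ ≤ C / R ^ r := by
  have hp : HasFPowerSeriesOnBall f (.ofScalars ℂ c) 0 ⊤ := by
    refine ⟨?_, by simp, fun {y} _ ↦ ?_⟩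
    · refine ENNReal.le_of_forall_nnreal_lt fun ρ _ ↦ ?_
      refine FormalMultilinearSeries.le_radius_of_summable_norm _ ?_
      refine (hf ρ).summable.norm.congr fun m ↦ ?_
      simp
    · simpa [FormalMultilinearSeries.ofScalars_apply_eq, mul_comm] using hf y
  have hd : Differentiable ℂ f := fun t ↦
    (hp.differentiableOn t (by simp)).differentiableAt (by simp)
  have h₁ := Complex.norm_iteratedDeriv_le_of_forall_mem_sphere_norm_le (c := 0) r hR
    hd.diffContOnCl (fun z hz ↦ hC z (by simpa using hz))
  have h₂ : iteratedDeriv r f 0 = r.factorial * c r := by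
    have := hp.factorial_smul 1 r
    simpa [iteratedDeriv_eq_iteratedFDeriv, FormalMultilinearSeries.ofScalars_apply_eq]
      using this.symm
  rw [h₂, norm_mul, Complex.norm_natCast, mul_div_assoc] at h₁
  exact le_of_mul_le_mul_left h₁ (by positivity)

/-- Apply `1 + x ≤ exp x` to `|1+z|² = 1 + (2 Re z + |z|²)`; the linear term `Re z` cancels against
`exp(-z)`. -/
lemma norm_one_add_mul_exp_neg_le (z : ℂ) :
    ‖(1 + z) * Complex.exp (-z)‖ ≤ Real.exp (‖z‖ ^ 2 / 2) := by
  have h₀ : ‖1 + z‖ ^ 2 = 1 + (2 * z.re + ‖z‖ ^ 2) := by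
    rw [Complex.sq_norm, Complex.sq_norm, Complex.normSq_apply, Complex.normSq_apply]
    simp
    ring
  have h₁ : ‖1 + z‖ ≤ Real.exp (z.re + ‖z‖ ^ 2 / 2) := by
    refine le_of_sq_le_sq ?_ (Real.exp_pos _).le
    rw [h₀, ← Real.exp_nat_mul, add_comm]
    refine (Real.add_one_le_exp _).trans_eq ?_
    congr 1
    push_cast
    ring
  rw [norm_mul, Complex.norm_exp]
  calc _ ≤ Real.exp (z.re + ‖z‖ ^ 2 / 2) * Real.exp ((-z).re) := by gcongr
    _ = _ := by rw [← Real.exp_add]; simp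

open scoped Nat in
/-- An explicit upper bound in Stirling's formula. -/
lemma factorial_le_stirling {r : ℕ} (hr : r ≠ 0) :
    (r ! : ℝ) ≤ Real.exp 1 * √r * (r / Real.exp 1) ^ r := by
  obtain ⟨m, rfl⟩ := Nat.exists_eq_succ_of_ne_zero hr
  -- The Stirling ratio decreases from its first value `e/√2`.
  have h : Stirling.stirlingSeq (m + 1) ≤ Stirling.stirlingSeq 1 :=
    Stirling.stirlingSeq'_antitone (Nat.zero_le m)
  rw [Stirling.stirlingSeq_one, Stirling.stirlingSeq, div_le_iff₀ (by positivity)] at h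
  refine h.trans_eq ?_
  rw [Real.sqrt_mul (by norm_num)]
  simp only [Nat.succ_eq_add_one]
  field_simp

open scoped Nat in
/-- If the coefficients `c r` satisfy Cauchy's estimate for a function of Gaussian growth, then the
weighted squares `c r ^ 2 * r ! / a ^ r` decay geometrically. -/
lemma sq_mul_factorial_div_pow_le {a b c : ℝ} (ha : 0 < a) (hb : 0 < b) {r : ℕ} (hr : r ≠ 0)
    (hc : ∀ R : ℝ, 0 < R → |c| ≤ Real.exp (b * R ^ 2 / 2) / R ^ r) :
    c ^ 2 * (r ! / a ^ r) ≤ (r + 9 / 4) * (b / a) ^ r := by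
  have hr' : (0 : ℝ) < r := by positivity
  have h₁ : c ^ 2 ≤ Real.exp 1 ^ r * b ^ r / r ^ r := by
    -- This radius minimizes `exp(bR²/2) / R^r`.
    have h := hc √(r / b) (by positivity)
    rw [← sq_abs]
    refine (pow_le_pow_left₀ (abs_nonneg _) h 2).trans_eq ?_
    rw [div_pow, ← pow_mul, mul_comm r 2, pow_mul, Real.sq_sqrt (by positivity),
      ← Real.exp_nat_mul, ← Real.exp_nat_mul, div_pow]
    have : ((2 : ℕ) : ℝ) * (b * (r / b) / 2) = r * 1 := by
      push_cast
      field_simp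
    rw [this]
    field_simp
  -- Tangent line of the square root at `9/4`; its slope `1/3` cancels the bound `e ≤ 3`.
  have h₂ : √(r : ℝ) ≤ r / 3 + 3 / 4 := by
    have := Real.sq_sqrt hr'.le
    nlinarith [sq_nonneg (√(r : ℝ) - 3 / 2)]
  have h₃ : Real.exp 1 ≤ 3 := Real.exp_one_lt_three.le
  calc c ^ 2 * (r ! / a ^ r)
      ≤ (Real.exp 1 ^ r * b ^ r / r ^ r) *
        (Real.exp 1 * √r * (r / Real.exp 1) ^ r / a ^ r) := by
        gcongr
        exact factorial_le_stirling hr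
    _ = Real.exp 1 * √r * (b / a) ^ r := by
        rw [div_pow, div_pow]
        field_simp
    _ ≤ 3 * (r / 3 + 3 / 4) * (b / a) ^ r := by gcongr
    _ = _ := by ring

lemma hasSum_sub_one_le_of_le_mul_pow {f : ℕ → ℝ} {x S : ℝ} (hf : HasSum f S) (h0 : f 0 = 1) (h1 : f 1 = 0)
    (hx : 0 ≤ x) (hx' : x ≤ 1 / 2) (hle : ∀ r, r ≠ 0 → f r ≤ (r + 9 / 4) * x ^ r) :
    S - 1 ≤ 15 * x ^ 2 := by
  have h := (hasSum_nat_add_iff' 2).2 hf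
  rw [Finset.sum_range_succ, Finset.sum_range_one, h0, h1, add_zero] at h
  -- With `r = m + 2`, the factor `r + 9/4` is `m + 17/4`, and `x^m ≤ 2^(-m)`.
  have hg : HasSum (fun m : ℕ ↦ x ^ 2 * ((m : ℝ) * (1 / 2) ^ m + 17 / 4 * (1 / 2) ^ m))
      (x ^ 2 * (2 + 17 / 4 * 2)) := by
    refine HasSum.mul_left _ (HasSum.add ?_ (hasSum_geometric_two.mul_left _))
    convert! hasSum_coe_mul_geometric_of_norm_lt_one (r := (1 / 2 : ℝ)) (by norm_num) using 1
    norm_num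
  refine (hasSum_le (fun m ↦ ?_) h hg).trans (by nlinarith [sq_nonneg x])
  calc f (m + 2) ≤ ((m + 2 : ℕ) + 9 / 4) * x ^ (m + 2) := hle _ (by omega)
    _ = (m + 17 / 4) * (x ^ 2 * x ^ m) := by push_cast; ring
    _ ≤ (m + 17 / 4) * (x ^ 2 * (1 / 2) ^ m) := by gcongr
    _ = _ := by ring

/-! ### Divergences, and the `χ²`-divergence from a Poisson law. -/

lemma klFun_le_sub_one_sq {x : ℝ} (hx : 0 ≤ x) : klFun x ≤ (x - 1) ^ 2 := by
  rw [klFun_apply]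
  rcases hx.eq_or_lt with rfl | hx
  · norm_num
  · nlinarith [mul_le_mul_of_nonneg_left (Real.log_le_sub_one_of_pos hx) hx.le]

/-- The Kullback-Leibler divergence is at most the `χ²`-divergence. -/
lemma klDiv_le_chiSqDiv {P Q : Measure ℕ} [IsFiniteMeasure P] [IsFiniteMeasure Q] (h : P ≪ Q) :
    klDiv P Q ≤ chiSqDiv P Q := by
  rw [klDiv_eq_lintegral_klFun_of_ac h, lintegral_countable', chiSqDiv]
  refine ENNReal.tsum_le_tsum fun k ↦ ?_
  by_cases hk : Q {k} = 0
  · simp [hk]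
  have hd : P {k} = P.rnDeriv Q k * Q {k} := by
    conv_lhs => rw [← Measure.withDensity_rnDeriv_eq P Q h]
    rw [withDensity_apply _ (measurableSet_singleton k), lintegral_singleton]
  have hq : 0 < Q.real {k} := ENNReal.toReal_pos hk (measure_ne_top _ _)
  have hd' : P.real {k} = (P.rnDeriv Q k).toReal * Q.real {k} := by
    rw [measureReal_def, hd, ENNReal.toReal_mul, measureReal_def]
  rw [← ofReal_measureReal, ← ENNReal.ofReal_div_of_pos hq, ← ENNReal.ofReal_mul' hq.le, hd']
  refine ENNReal.ofReal_le_ofReal ?_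
  rw [le_div_iff₀ hq]
  have := klFun_le_sub_one_sq (x := (P.rnDeriv Q k).toReal) ENNReal.toReal_nonneg
  calc _ = klFun (P.rnDeriv Q k).toReal * Q.real {k} ^ 2 := by ring
    _ ≤ ((P.rnDeriv Q k).toReal - 1) ^ 2 * Q.real {k} ^ 2 := by gcongr
    _ = _ := by ring

lemma integral_eq_sum_of_ae_mem {E : Type*} [NormedAddCommGroup E] [NormedSpace ℝ E]
    [CompleteSpace E] {P : Measure ℕ} [IsFiniteMeasure P] {s : Finset ℕ} (hs : ∀ᵐ k ∂P, k ∈ s)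
    (f : ℕ → E) : ∫ k, f k ∂P = ∑ k ∈ s, P.real {k} • f k := by
  have h : P.restrict (s : Set ℕ) = P := Measure.restrict_eq_self_of_ae_mem (by simpa using hs)
  conv_lhs => rw [← h]
  exact setIntegral_finset s IntegrableOn.finset

lemma absolutelyContinuous_poissonMeasure {r : ℝ≥0} (hr : 0 < r) (P : Measure ℕ) :
    P ≪ poissonMeasure r := by
  intro s hs
  have : s = ∅ := by
    refine Set.eq_empty_of_forall_notMem fun k hk ↦ ?_
    have h := poissonMeasure_real_singleton_pos k hr
    rw [measureReal_def, measure_mono_null (Set.singleton_subset_iff.2 hk) hs] at h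
    simp at h
  simp [this]

open scoped Nat in
/-- The `χ²`-divergence of a finitely supported law from a Poisson law. -/
lemma chiSqDiv_poissonMeasure {P : Measure ℕ} [IsProbabilityMeasure P] {s : Finset ℕ}
    (hs : ∀ᵐ k ∂P, k ∈ s) {r : ℝ≥0} (hr : 0 < r) :
    chiSqDiv P (poissonMeasure r) =
      ENNReal.ofReal (∑ k ∈ s, P.real {k} ^ 2 * (Real.exp r * k ! / r ^ k) - 1) := by
  have hout : ∀ k ∉ s, P.real {k} = 0 := fun k hk ↦ by
    rw [measureReal_def, measure_mono_null (t := {k | ¬ k ∈ s}) (by simpa using hk) hs]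
    rfl
  have hone : ∑ k ∈ s, P.real {k} = 1 := by
    simpa using (integral_eq_sum_of_ae_mem hs fun _ ↦ (1 : ℝ)).symm
  have hsum : HasSum (fun k ↦ (P.real {k} - (poissonMeasure r).real {k}) ^ 2 /
      (poissonMeasure r).real {k})
      (∑ k ∈ s, P.real {k} ^ 2 * (Real.exp r * k ! / r ^ k) - 1) := by
    have h₁ : HasSum (fun k ↦ P.real {k} ^ 2 * (Real.exp r * k ! / r ^ k))
        (∑ k ∈ s, P.real {k} ^ 2 * (Real.exp r * k ! / r ^ k)) :=
      hasSum_sum_of_ne_finset_zero fun k hk ↦ by simp [hout k hk]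
    have h₂ : HasSum (fun k ↦ P.real {k}) 1 :=
      hone ▸ hasSum_sum_of_ne_finset_zero hout
    have h₃ := hasSum_one_poissonMeasure r
    -- Termwise `(w - v)²/v = w²/v - 2w + v`, and both laws have mass one.
    convert! (h₁.sub (h₂.mul_left 2)).add h₃ using 1
    · ext k
      have hr' : (r : ℝ) ≠ 0 := by positivity
      rw [poissonMeasure_real_singleton, Real.exp_neg]
      field_simp
      ring
    · ring
  rw [← hsum.tsum_eq, ENNReal.ofReal_tsum_of_nonneg (fun k ↦ by positivity) hsum.summable, chiSqDiv]
  refine tsum_congr fun k ↦ ?_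
  rw [ENNReal.ofReal_div_of_pos (poissonMeasure_real_singleton_pos k hr), ofReal_measureReal]

/-! ### Support, generating function and mean of the Bernoulli sum. -/

section BernoulliSum

variable {Ω : Type*} [MeasurableSpace Ω] {μ : Measure Ω} {n : ℕ} {p : Fin n → unitInterval}
  {X : Fin n → Ω → ℕ}

lemma ae_sum_le_of_hasLaw_bernoulliMeasure
    (hX : ∀ j, HasLaw (X j) (bernoulliMeasure 1 0 (p j)) μ) :
    ∀ᵐ ω ∂μ, ∑ j, X j ω ≤ n := by
  have h : ∀ j, ∀ᵐ ω ∂μ, X j ω ≤ 1 := fun j ↦ by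
    rw [(hX j).ae_iff (p := fun k ↦ k ≤ 1) (by fun_prop), ae_iff]
    exact bernoulliMeasure_apply_of_notMem_of_notMem _ (by measurability) (by simp) (by simp)
  filter_upwards [ae_all_iff.2 h] with ω hω
  simpa using Finset.sum_le_sum fun j (_ : j ∈ Finset.univ) ↦ hω j

lemma integral_one_add_pow_sum_bernoulli
    (hX : ∀ j, HasLaw (X j) (bernoulliMeasure 1 0 (p j)) μ) (hindep : iIndepFun X μ) (t : ℂ) :
    ∫ ω, (1 + t) ^ (∑ j, X j ω) ∂μ = ∏ j, (1 + (p j : ℝ) * t) := by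
  simp_rw [← Finset.prod_pow_eq_pow_sum]
  rw [hindep.integral_fun_prod_comp (f := fun _ k ↦ (1 + t) ^ k) (fun j ↦ (hX j).aemeasurable)
    (fun j ↦ .of_discrete)]
  refine Finset.prod_congr rfl fun j _ ↦ ?_
  have h := (hX j).integral_comp (f := fun k ↦ (1 + t) ^ k) .of_discrete
  rw [Function.comp_def] at h
  rw [h, integral_bernoulliMeasure]
  simp
  ring

lemma integral_sum_bernoulli (hX : ∀ j, HasLaw (X j) (bernoulliMeasure 1 0 (p j)) μ) :
    ∫ ω, ((∑ j, X j ω : ℕ) : ℝ) ∂μ = ∑ j, (p j : ℝ) := by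
  push_cast
  have hint : ∀ j, Integrable (fun ω ↦ (X j ω : ℝ)) μ := fun j ↦ by
    have h := integrable_bernoulliMeasure 1 0 (p j) (fun k : ℕ ↦ (k : ℝ))
    rw [← (hX j).map_eq] at h
    exact h.comp_aemeasurable (hX j).aemeasurable
  rw [integral_finsetSum _ fun j _ ↦ hint j]
  refine Finset.sum_congr rfl fun j _ ↦ ?_
  have h := (hX j).integral_comp (f := fun k : ℕ ↦ (k : ℝ)) .of_discrete
  rw [Function.comp_def] at h
  rw [h, integral_bernoulliMeasure]
  simp

end BernoulliSum

lemma norm_exp_mul_prod_one_add_le {ι : Type*} (s : Finset ι) (p : ι → ℝ) (t : ℂ) :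
    ‖Complex.exp (-(∑ j ∈ s, p j : ℝ) * t) * ∏ j ∈ s, (1 + p j * t)‖ ≤
      Real.exp ((∑ j ∈ s, p j ^ 2) * ‖t‖ ^ 2 / 2) := by
  -- Each factor `1 + p_j t` takes its share `exp(-p_j t)` of the exponential.
  have h : Complex.exp (-(∑ j ∈ s, p j : ℝ) * t) * ∏ j ∈ s, (1 + p j * t) =
      ∏ j ∈ s, ((1 + p j * t) * Complex.exp (-(p j * t))) := by
    rw [Finset.prod_mul_distrib, ← Complex.exp_sum, mul_comm]
    congr 2
    push_cast
    rw [Finset.sum_neg_distrib, neg_mul, Finset.sum_mul]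
  rw [h, norm_prod, Finset.sum_mul, Finset.sum_div, Real.exp_sum]
  refine Finset.prod_le_prod (fun _ _ ↦ norm_nonneg _) fun j _ ↦ ?_
  refine (norm_one_add_mul_exp_neg_le _).trans_eq ?_
  rw [norm_mul, mul_pow, Complex.norm_real, Real.norm_eq_abs, sq_abs]

/-! ### Assembly of the bound. -/

/-- The `χ²`-distance of a sum of independent Bernoulli variables from the Poisson law with the
same mean, by the Charlier expansion. -/
lemma chiSqDiv_map_sum_bernoulli_le {Ω : Type*} [MeasurableSpace Ω] {μ : Measure Ω}
    [IsProbabilityMeasure μ] {n : ℕ} {p : Fin n → unitInterval} {X : Fin n → Ω → ℕ}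
    (hX : ∀ j, HasLaw (X j) (bernoulliMeasure 1 0 (p j)) μ) (hindep : iIndepFun X μ)
    {a : ℝ≥0} (ha : (a : ℝ) = ∑ j, (p j : ℝ)) (ha_pos : 0 < a)
    (hle : ∑ j, (p j : ℝ) ^ 2 ≤ a / 2) :
    chiSqDiv (μ.map fun ω ↦ ∑ j, X j ω) (poissonMeasure a) ≤
      ENNReal.ofReal (15 * ((∑ j, (p j : ℝ) ^ 2) / a) ^ 2) := by
  have ha' : (0 : ℝ) < a := ha_pos
  have hW : AEMeasurable (fun ω ↦ ∑ j, X j ω) μ :=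
    Finset.aemeasurable_fun_sum _ fun j _ ↦ (hX j).aemeasurable
  set P := μ.map fun ω ↦ ∑ j, X j ω with hP
  have : IsProbabilityMeasure P := Measure.isProbabilityMeasure_map hW
  set s := Finset.range (n + 1)
  have hs : ∀ᵐ k ∂P, k ∈ s := by
    rw [hP, ae_map_iff hW (by measurability)]
    filter_upwards [ae_sum_le_of_hasLaw_bernoulliMeasure hX] with ω hω
    exact Finset.mem_range_succ_iff.2 hω
  set b := ∑ j, (p j : ℝ) ^ 2 with hb
  -- Needed for the Cauchy radius `√(r/b)`; a positive mean forces some `p_j > 0`.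
  have hb_pos : 0 < b := by
    have hj : ∃ j ∈ Finset.univ, (0 : ℝ) < p j := by
      by_contra! h
      exact absurd (Finset.sum_nonpos h) (by rw [← ha]; exact not_le.2 ha')
    obtain ⟨j, hj, hpj⟩ := hj
    exact Finset.sum_pos' (fun _ _ ↦ sq_nonneg _) ⟨j, hj, by positivity⟩
  set c : ℕ → ℝ := fun r ↦ ∑ k ∈ s, P.real {k} * charlierCoeff a k r with hc
  have hone : ∑ k ∈ s, P.real {k} = 1 := by
    simpa using (integral_eq_sum_of_ae_mem hs fun _ ↦ (1 : ℝ)).symm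
  have hmean : ∑ k ∈ s, P.real {k} * (k : ℝ) = a := by
    have h := integral_eq_sum_of_ae_mem hs fun k ↦ (k : ℝ)
    rw [hP, integral_map hW .of_discrete, integral_sum_bernoulli hX, ← ha] at h
    simpa using h.symm
  have hc0 : c 0 = 1 := by simpa [hc, charlierCoeff.zero_right] using hone
  have hc1 : c 1 = 0 := by
    simp only [hc, charlierCoeff.one_right, mul_sub, Finset.sum_sub_distrib, ← Finset.sum_mul,
      hone, hmean, one_mul, sub_self]
  have hgen : ∀ t : ℂ, HasSum (fun r ↦ (c r : ℂ) * t ^ r)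
      (Complex.exp (-(∑ j, (p j : ℝ) : ℝ) * t) * ∏ j, (1 + (p j : ℝ) * t)) := fun t ↦ by
    have h := hasSum_sum (s := s) fun k _ ↦
      (charlierCoeff.hasSum_mul_pow (a := a) k t).mul_left (P.real {k} : ℂ)
    convert! h using 1
    · ext r
      simp only [hc]
      push_cast
      rw [Finset.sum_mul]
      exact Finset.sum_congr rfl fun k _ ↦ by ring
    · have h := integral_eq_sum_of_ae_mem hs fun k ↦ (1 + t) ^ k
      rw [hP, integral_map hW .of_discrete, integral_one_add_pow_sum_bernoulli hX hindep] at h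
      rw [h, ← ha, Finset.mul_sum]
      refine Finset.sum_congr rfl fun k _ ↦ ?_
      rw [Complex.real_smul]
      ring
  have hcauchy : ∀ (r : ℕ) (R : ℝ), 0 < R → |c r| ≤ Real.exp (b * R ^ 2 / 2) / R ^ r :=
    fun r R hR ↦ by
    have h := norm_le_of_hasSum_mul_pow hgen hR (C := Real.exp (b * R ^ 2 / 2))
      (fun t ht ↦ by
        simpa [ht] using norm_exp_mul_prod_one_add_le Finset.univ (fun j ↦ (p j : ℝ)) t) r
    rwa [Complex.norm_real, Real.norm_eq_abs] at h
  rw [chiSqDiv_poissonMeasure hs ha_pos]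
  refine ENNReal.ofReal_le_ofReal ?_
  refine hasSum_sub_one_le_of_le_mul_pow (hasSum_sq_sum_charlierCoeff ha'.ne' s fun k ↦ P.real {k})
    ?_ ?_ (by positivity) ?_ fun r hr ↦ sq_mul_factorial_div_pow_le ha' hb_pos hr (hcauchy r)
  · change c 0 ^ 2 * _ = 1
    simp [hc0]
  · change c 1 ^ 2 * _ = 0
    simp [hc1]
  · rw [div_le_iff₀ ha']
    linarith

theorem theorem1p2 {Ω Ω' : Type*} [MeasurableSpace Ω] [MeasurableSpace Ω']
    (μ : Measure Ω) [IsProbabilityMeasure μ] (μ' : Measure Ω') [IsProbabilityMeasure μ']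
    (n : ℕ) (p : Fin n → unitInterval)
    (X : Fin n → Ω → ℕ)
    (hX : ∀ j, HasLaw (X j) (bernoulliMeasure 1 0 (p j)) μ)
    (hindep : iIndepFun X μ)
    (W : Ω → ℕ) (hW : ∀ ω, W ω = ∑ j, X j ω)
    (lam : ℝ≥0) (hlam : (lam : ℝ) = ∑ j, (p j : ℝ)) (hlam_pos : 0 < lam)
    (lam₂ : ℝ) (hlam₂ : lam₂ = ∑ j, (p j : ℝ) ^ 2)
    (Z : Ω' → ℕ) (hZ : HasLaw Z (poissonMeasure lam) μ')
    (hle : lam₂ ≤ (lam : ℝ) / 2) :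
    klDiv (μ.map W) (μ'.map Z) ≤ chiSqDiv (μ.map W) (μ'.map Z) ∧
    chiSqDiv (μ.map W) (μ'.map Z) ≤ ENNReal.ofReal (56 * 10 ^ 6 * (lam₂ / (lam : ℝ)) ^ 2) ∧
    ((lam : ℝ) ≤ 1 / 2 →
      chiSqDiv (μ.map W) (μ'.map Z) ≤ ENNReal.ofReal (15 * (lam₂ / (lam : ℝ)) ^ 2)) := by
  obtain rfl : W = fun ω ↦ ∑ j, X j ω := funext hW
  subst hlam₂
  rw [hZ.map_eq]
  have h := chiSqDiv_map_sum_bernoulli_le hX hindep hlam hlam_pos hle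
  refine ⟨klDiv_le_chiSqDiv (absolutelyContinuous_poissonMeasure hlam_pos _), h.trans ?_,
    fun _ ↦ h⟩
  refine ENNReal.ofReal_le_ofReal ?_
  gcongr
  norm_num
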